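/- Let $d\ge 1$ and let $\alpha_1,\dots,\alpha_d$ be real numbers with $2\sum_{i=1}^d\alpha_i=1$. Let $0<c<\min\{\alpha_1,\dots,\alpha_d\}$, and for each $i$ let $\tilde\alpha_i:\mathbb{Z}\to\mathbb{R}$ be a function with $c\le\tilde\alpha_i(n)\le\alpha_i$ for all $n\in\mathbb{Z}$. Let $\mathbf{S}_t=(S_t^{(1)},\dots,S_t^{(d)})$, $t=0,1,2,\dots$, be a random walk in $\mathbb{Z}^d$ with $\mathbf{S}_0=\mathbf{0}$ which, given its history up to time $t-1$, makes at time $t\geq 1$ each of the steps $+\mathbf{1}_i$ and $-\mathbf{1}_i$ ($i=1,\dots,d$, where $\mathbf{1}_i$ is the $i$-th unit vector) with probability $\tilde\alpha_i\big(S_{t-1}^{(i)}\big)$, and stays where it is with the complementary probability $1-2\sum_{i=1}^d\tilde\alpha_i\big(S_{t-1}^{(i)}\big)$. If $d\le2$, then the walk is recurrent: almost surely $\mathbf{S}_t=\mathbf{0}$ for infinitely many $t$. If $d\ge3$, then the walk is transient: almost surely $\mathbf{S}_t=\mathbf{0}$ for only finitely many $t$. -/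

import Mathlib

open MeasureTheory

/-- Admissible parameters of the walk in dimension `d`: `a i n` is the probability of the step
`+1_i`, and also of the step `-1_i`, when the current `i`-th coordinate is `n`. It lies between
a constant `c > 0` and `α i`, where `2 (α_1 + ⋯ + α_d) = 1`. -/
structure IsModelFour (d : ℕ) (α : Fin d → ℝ) (c : ℝ) (a : Fin d → ℤ → ℝ) : Prop where
  two_mul_sum : 2 * ∑ i, α i = 1
  c_pos : 0 < c
  c_lt : ∀ i, c < α i
  le_prob : ∀ i n, c ≤ a i n
  prob_le : ∀ i n, a i n ≤ α i

/-- `S` is a random walk on `ℤ^d` started at `0` which, given any history `S_0 = x_0, …, S_t = x_t`,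
makes each of the steps `+1_i` and `-1_i` with (conditional) probability `a i (x_t^{(i)})`, and
stays where it is with the complementary probability. -/
structure IsLazyWalk {Ω : Type*} [MeasurableSpace Ω] (P : Measure Ω) {d : ℕ}
    (a : Fin d → ℤ → ℝ) (S : ℕ → Ω → Fin d → ℤ) : Prop where
  measurable : ∀ t, Measurable (S t)
  start : ∀ᵐ ω ∂P, S 0 ω = 0
  step_up : ∀ (t : ℕ) (x : ℕ → Fin d → ℤ) (i : Fin d),
    P.real {ω | (∀ s ≤ t, S s ω = x s) ∧ S (t + 1) ω = x t + Pi.single i 1} =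
      a i (x t i) * P.real {ω | ∀ s ≤ t, S s ω = x s}
  step_down : ∀ (t : ℕ) (x : ℕ → Fin d → ℤ) (i : Fin d),
    P.real {ω | (∀ s ≤ t, S s ω = x s) ∧ S (t + 1) ω = x t - Pi.single i 1} =
      a i (x t i) * P.real {ω | ∀ s ≤ t, S s ω = x s}
  stay : ∀ (t : ℕ) (x : ℕ → Fin d → ℤ),
    P.real {ω | (∀ s ≤ t, S s ω = x s) ∧ S (t + 1) ω = x t} =
      (1 - 2 * ∑ i, a i (x t i)) * P.real {ω | ∀ s ≤ t, S s ω = x s}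

/-- Almost surely the walk is at the origin infinitely often. -/
def IsRecurrentWalk {Ω : Type*} [MeasurableSpace Ω] (P : Measure Ω) {d : ℕ}
    (S : ℕ → Ω → Fin d → ℤ) : Prop :=
  ∀ᵐ ω ∂P, ∃ᶠ t in Filter.atTop, S t ω = 0

/-- Almost surely the walk is at the origin only finitely often. -/
def IsTransientWalk {Ω : Type*} [MeasurableSpace Ω] (P : Measure Ω) {d : ℕ}
    (S : ℕ → Ω → Fin d → ℤ) : Prop :=
  ∀ᵐ ω ∂P, ∀ᶠ t in Filter.atTop, S t ω ≠ 0

/-! The walk is reversible with respect to `π(x) = 1 / ∏ i, a i (x i)`: an edge in direction `i` has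
conductance `1 / ∏_{j ≠ i} a j (x j)`, the same seen from both ends and lying between `1` and `1 / c
^ d`. Its Dirichlet form `E` is therefore comparable with that of simple random walk on `ℤ^d`.

Let `G_T` be the expected number of visits before time `T`, divided by `π`. Detailed balance turns
the evolution of the law into the generator and the sum over time telescopes, so `E(G_T, g) = g(0) -
𝔼 g(S_T)` for finitely supported `g` (`dirichletForm_greenDensity`). Taking `g = G_T` gives `E(G_T,
G_T) ≤ G_T(0)`.

For `d ≥ 3` a Hardy inequality bounds `F(0)²` by `213 E(F, F)` (`sq_apply_zero_le`). Hence `G_T(0) ≤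
213` for every `T`, and Borel–Cantelli gives transience.

For `d ≤ 2` there are `g` with `g(0) = 1` and arbitrarily small energy (`exists_cutoff`). If
`G_T(0)` stayed bounded, the law of `S_T` would tend to zero pointwise, so `E(G_T, g) → 1`, whereas
Cauchy–Schwarz keeps `E(G_T, g)` small. So the expected number of visits is infinite, and
decomposing at the last visit (`avoidProb_mul_sum_le`) turns this into recurrence. -/

/-- The reciprocal of the reversible measure of the walk. -/
noncomputable def invMass {d : ℕ} (a : Fin d → ℤ → ℝ) (x : Fin d → ℤ) : ℝ := ∏ i, a i (x i)

/-- The conductance of the edge from `x` to `x + 1_i`. -/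
noncomputable def conductance {d : ℕ} (a : Fin d → ℤ → ℝ) (i : Fin d) (x : Fin d → ℤ) : ℝ :=
  a i (x i) / invMass a x

/-- The generator of the walk. -/
noncomputable def generator {d : ℕ} (a : Fin d → ℤ → ℝ) (F : (Fin d → ℤ) → ℝ)
    (x : Fin d → ℤ) : ℝ :=
  ∑ i, a i (x i) * (F (x + Pi.single i 1) + F (x - Pi.single i 1) - 2 * F x)

/-- The Dirichlet form of the walk. -/
noncomputable def dirichletForm {d : ℕ} (a : Fin d → ℤ → ℝ) (F g : (Fin d → ℤ) → ℝ) : ℝ :=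
  ∑ i, ∑' x, conductance a i x *
    ((F (x + Pi.single i 1) - F x) * (g (x + Pi.single i 1) - g x))

/-! ### Reversibility and bounds on the conductances. -/

section Coefficients

variable {d : ℕ} {α : Fin d → ℝ} {c : ℝ} {a : Fin d → ℤ → ℝ}

theorem IsModelFour.pos (ha : IsModelFour d α c a) (i : Fin d) (n : ℤ) : 0 < a i n :=
  ha.c_pos.trans_le (ha.le_prob i n)

theorem IsModelFour.two_mul_sum_le (ha : IsModelFour d α c a) (x : Fin d → ℤ) :
    2 * ∑ i, a i (x i) ≤ 1 := by
  rw [← ha.two_mul_sum]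
  gcongr with i
  exact ha.prob_le i _

theorem IsModelFour.le_one (ha : IsModelFour d α c a) (i : Fin d) (n : ℤ) : a i n ≤ 1 := by
  have h1 := ha.two_mul_sum_le (fun _ => n)
  have h2 : a i n ≤ ∑ j, a j n :=
    Finset.single_le_sum (f := fun j => a j n) (fun j _ => (ha.pos j n).le) (Finset.mem_univ i)
  have := ha.pos i n
  linarith

theorem IsModelFour.invMass_pos (ha : IsModelFour d α c a) (x : Fin d → ℤ) : 0 < invMass a x :=
  Finset.prod_pos fun i _ => ha.pos i _

theorem invMass_add_single (a : Fin d → ℤ → ℝ) (i : Fin d) (x : Fin d → ℤ) (k : ℤ) :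
    invMass a (x + Pi.single i k) * a i (x i) = a i (x i + k) * invMass a x := by
  unfold invMass
  rw [← Finset.mul_prod_erase _ _ (Finset.mem_univ i),
    ← Finset.mul_prod_erase Finset.univ (fun j => a j (x j)) (Finset.mem_univ i)]
  have : ∏ j ∈ Finset.univ.erase i, a j ((x + Pi.single i k : Fin d → ℤ) j) =
      ∏ j ∈ Finset.univ.erase i, a j (x j) := by
    refine Finset.prod_congr rfl fun j hj => ?_
    simp [Pi.single_eq_of_ne (Finset.ne_of_mem_erase hj)]
  rw [this]
  simp
  ring

/-- The factor `a i (x i)` cancels, so the conductance does not involve the `i`-th coordinate. This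
is detailed balance, and it is what permits summation by parts. -/
theorem IsModelFour.conductance_add (ha : IsModelFour d α c a) (i : Fin d) (x : Fin d → ℤ) :
    conductance a i (x + Pi.single i 1) = conductance a i x := by
  have h := invMass_add_single a i x 1
  unfold conductance
  rw [div_eq_div_iff (ha.invMass_pos _).ne' (ha.invMass_pos _).ne']
  simp only [Pi.add_apply, Pi.single_eq_same]
  linarith

theorem IsModelFour.one_le_conductance (ha : IsModelFour d α c a) (i : Fin d) (x : Fin d → ℤ) :
    1 ≤ conductance a i x := by
  unfold conductance
  rw [one_le_div (ha.invMass_pos x), invMass, ← Finset.mul_prod_erase _ _ (Finset.mem_univ i)]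
  exact mul_le_of_le_one_right (ha.pos _ _).le
    (Finset.prod_le_one (fun j _ => (ha.pos j _).le) fun j _ => ha.le_one j _)

theorem IsModelFour.conductance_le (ha : IsModelFour d α c a) (i : Fin d) (x : Fin d → ℤ) :
    conductance a i x ≤ 1 / c ^ d := by
  have hc := ha.c_pos
  have h : c ^ d ≤ invMass a x := by
    calc c ^ d = ∏ _i : Fin d, c := by simp
      _ ≤ _ := Finset.prod_le_prod (fun _ _ => hc.le) fun j _ => ha.le_prob j _
  exact div_le_div₀ zero_le_one (ha.le_one i _) (by positivity) h

end Coefficients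

/-! ### Finitely supported functions and translations. -/

section Shift

theorem summable_mul_of_finite_support {G : Type*} {g : G → ℝ} (hg : g.support.Finite) (h : G → ℝ) :
    Summable fun x => h x * g x :=
  summable_of_hasFiniteSupport (hg.subset (Function.support_mul_subset_right h g))

variable {G : Type*} [AddCommGroup G]

theorem finite_support_comp_add {g : G → ℝ} (hg : g.support.Finite) (v : G) :
    (fun x => g (x + v)).support.Finite :=
  hg.preimage (f := fun x => x + v) (add_left_injective v).injOn

theorem finite_support_diff {g : G → ℝ} (hg : g.support.Finite) (v : G) :
    (fun x => g (x + v) - g x).support.Finite :=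
  ((finite_support_comp_add hg v).union hg).subset (Function.support_sub _ _)

theorem tsum_comp_add (f : G → ℝ) (v : G) : ∑' x, f (x + v) = ∑' x, f x :=
  (Equiv.addRight v).tsum_eq f

end Shift

/-! ### Green's formula and Cauchy–Schwarz for the Dirichlet form. -/

section Green

variable {d : ℕ} {α : Fin d → ℝ} {c : ℝ} {a : Fin d → ℤ → ℝ}

/-- Summation by parts. -/
theorem IsModelFour.tsum_mul_generator (ha : IsModelFour d α c a) (F : (Fin d → ℤ) → ℝ)
    {g : (Fin d → ℤ) → ℝ} (hg : g.support.Finite) :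
    ∑' x, g x * generator a F x / invMass a x = -dirichletForm a F g := by
  have key : ∀ i, ∑' x, conductance a i x * (F (x + Pi.single i 1) + F (x - Pi.single i 1)
      - 2 * F x) * g x = -∑' x, conductance a i x *
        ((F (x + Pi.single i 1) - F x) * (g (x + Pi.single i 1) - g x)) := by
    intro i
    have h1 : ∑' x, conductance a i x * (F x - F (x - Pi.single i 1)) * g x =
        ∑' x, conductance a i x * (F (x + Pi.single i 1) - F x) * g (x + Pi.single i 1) := by
      rw [← tsum_comp_add _ (Pi.single i (1 : ℤ))]
      refine tsum_congr fun x => ?_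
      rw [ha.conductance_add, add_sub_cancel_right]
    calc _ = ∑' x, (conductance a i x * (F (x + Pi.single i 1) - F x) * g x -
          conductance a i x * (F x - F (x - Pi.single i 1)) * g x) :=
          tsum_congr fun x => by ring
      _ = ∑' x, conductance a i x * (F (x + Pi.single i 1) - F x) * g x -
          ∑' x, conductance a i x * (F (x + Pi.single i 1) - F x) * g (x + Pi.single i 1) := by
          rw [(summable_mul_of_finite_support hg _).tsum_sub
            (summable_mul_of_finite_support hg _), h1]
      _ = _ := by
          rw [← (summable_mul_of_finite_support hg _).tsum_sub
            (summable_mul_of_finite_support (finite_support_comp_add hg _) _), ← tsum_neg]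
          exact tsum_congr fun x => by ring
  calc _ = ∑' x, ∑ i, conductance a i x * (F (x + Pi.single i 1) + F (x - Pi.single i 1)
      - 2 * F x) * g x := by
        refine tsum_congr fun x => ?_
        rw [generator, Finset.mul_sum, Finset.sum_div]
        exact Finset.sum_congr rfl fun i _ => by rw [conductance]; ring
    _ = _ := by
        rw [Summable.tsum_finsetSum fun i _ => summable_mul_of_finite_support hg _, dirichletForm,
          ← Finset.sum_neg_distrib]
        exact Finset.sum_congr rfl fun i _ => key i

/-- A weighted Cauchy–Schwarz inequality. -/
theorem IsModelFour.two_mul_dirichletForm_le (ha : IsModelFour d α c a) {F g : (Fin d → ℤ) → ℝ}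
    (hF : F.support.Finite) (hg : g.support.Finite) {r : ℝ} (hr : 0 < r) :
    2 * dirichletForm a F g ≤ r * dirichletForm a F F + r⁻¹ * dirichletForm a g g := by
  have hs : ∀ (u v : (Fin d → ℤ) → ℝ), v.support.Finite → ∀ i, Summable fun x =>
      conductance a i x * ((u (x + Pi.single i 1) - u x) * (v (x + Pi.single i 1) - v x)) := by
    intro u v hv i
    simpa only [mul_assoc] using summable_mul_of_finite_support
      (finite_support_diff hv (Pi.single i (1 : ℤ)))
      (fun x => conductance a i x * (u (x + Pi.single i 1) - u x))
  simp only [dirichletForm, Finset.mul_sum, ← Finset.sum_add_distrib, ← tsum_mul_left]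
  refine Finset.sum_le_sum fun i _ => ?_
  rw [← ((hs F F hF i).mul_left _).tsum_add ((hs g g hg i).mul_left _)]
  refine ((hs F g hg i).mul_left 2).tsum_le_tsum (fun x => ?_)
    (((hs F F hF i).mul_left _).add ((hs g g hg i).mul_left _))
  have h0 : 0 ≤ conductance a i x := zero_le_one.trans (ha.one_le_conductance i x)
  generalize F (x + Pi.single i 1) - F x = u
  generalize g (x + Pi.single i 1) - g x = v
  have h1 : 2 * (u * v) ≤ r * (u * u) + r⁻¹ * (v * v) := by
    have : r * (u * u) + r⁻¹ * (v * v) - 2 * (u * v) = r * (u - r⁻¹ * v) ^ 2 := by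
      field_simp; ring
    have : 0 ≤ r * (u - r⁻¹ * v) ^ 2 := by positivity
    linarith
  nlinarith [mul_le_mul_of_nonneg_left h1 h0]

end Green

/-! ### A discrete Hardy inequality in dimension at least three. -/

section Hardy

/-- On each edge, `(F (x + v) - F x)²` exceeds `(1 - θ x) F(x)² + (1 - (θ x)⁻¹) F(x + v)²` by a
nonnegative square; regrouping by vertices gives the weight. If `θ x = h (x + v) / h x`, the weights
summed over directions are `-Δh / h`, so a superharmonic `h` yields a Hardy inequality. -/
theorem tsum_edge_weight_mul_sq_le {G : Type*} [AddCommGroup G] {F : G → ℝ}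
    (hF : F.support.Finite) {θ : G → ℝ} (hθ : ∀ x, 0 < θ x) (v : G) :
    ∑' x, (1 - θ x + (1 - (θ (x - v))⁻¹)) * F x ^ 2 ≤ ∑' x, (F (x + v) - F x) ^ 2 := by
  have hF2 : (fun x => F x ^ 2).support.Finite :=
    hF.subset fun x hx => by contrapose! hx; simp_all
  have h1 : ∑' x, (1 - (θ (x - v))⁻¹) * F x ^ 2 = ∑' x, (1 - (θ x)⁻¹) * F (x + v) ^ 2 := by
    rw [← tsum_comp_add _ v]
    simp only [add_sub_cancel_right]
  have hs := summable_mul_of_finite_support hF2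
  have hs' := summable_mul_of_finite_support (finite_support_comp_add hF2 v)
  calc _ = ∑' x, ((1 - θ x) * F x ^ 2 + (1 - (θ x)⁻¹) * F (x + v) ^ 2) := by
        rw [(hs _).tsum_add (hs' _), ← h1, ← (hs _).tsum_add (hs _)]
        exact tsum_congr fun x => by ring
    _ ≤ _ := by
        refine ((hs _).add (hs' _)).tsum_le_tsum (fun x => ?_) ?_
        · have h := hθ x
          have h2 : (F (x + v) - F x) ^ 2 - ((1 - θ x) * F x ^ 2 + (1 - (θ x)⁻¹) * F (x + v) ^ 2)
              = (θ x)⁻¹ * (θ x * F x - F (x + v)) ^ 2 := by field_simp; ring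
          have h3 : 0 ≤ (θ x)⁻¹ * (θ x * F x - F (x + v)) ^ 2 := by positivity
          linarith
        · simpa only [sq] using summable_mul_of_finite_support (finite_support_diff hF v)
            (fun x => F (x + v) - F x)

/-- The squared Euclidean length, shifted by a constant. -/
noncomputable def shiftedSq {d : ℕ} (x : Fin d → ℤ) : ℝ := ∑ i, (x i : ℝ) ^ 2 + 10

theorem sq_add_ten_le_shiftedSq {d : ℕ} (x : Fin d → ℤ) (i : Fin d) :
    (x i : ℝ) ^ 2 + 10 ≤ shiftedSq x := by
  have := Finset.single_le_sum (f := fun i => (x i : ℝ) ^ 2) (fun i _ => sq_nonneg _)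
    (Finset.mem_univ i)
  unfold shiftedSq
  linarith

theorem shiftedSq_sub_single {d : ℕ} (x : Fin d → ℤ) (i : Fin d) :
    shiftedSq (x - Pi.single i 1) = shiftedSq x - 2 * x i + 1 := by
  unfold shiftedSq
  rw [← Finset.add_sum_erase _ _ (Finset.mem_univ i),
    ← Finset.add_sum_erase Finset.univ (fun j => (x j : ℝ) ^ 2) (Finset.mem_univ i)]
  have : ∑ j ∈ Finset.univ.erase i, (((x - Pi.single i 1 : Fin d → ℤ) j : ℤ) : ℝ) ^ 2 =
      ∑ j ∈ Finset.univ.erase i, (x j : ℝ) ^ 2 := by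
    refine Finset.sum_congr rfl fun j hj => ?_
    simp [Pi.single_eq_of_ne (Finset.ne_of_mem_erase hj)]
  rw [this]
  simp
  ring

/-- An approximation of the ratio of the values at `x + 1_i` and `x` of the superharmonic
function `|x| ^ (-1/2)`. -/
noncomputable def edgeRatio {d : ℕ} (i : Fin d) (x : Fin d → ℤ) : ℝ :=
  (shiftedSq x + 3 / 4 * x i + 3 / 8) / (shiftedSq x + 5 / 4 * x i + 5 / 8)

theorem edgeRatio_pos {d : ℕ} (i : Fin d) (x : Fin d → ℤ) : 0 < edgeRatio i x := by
  have h := sq_add_ten_le_shiftedSq x i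
  unfold edgeRatio
  apply div_pos <;> nlinarith [sq_nonneg ((x i : ℝ) + 1)]

/-- With `u = (2 x_i + 1) / shiftedSq x`, the exact ratio for `shiftedSq ^ (-1/4)` is `(1 + u) ^
(-1/4)`, and `edgeRatio` is its Padé approximant `(1 + 3u/8) / (1 + 5u/8)`. This choice makes the
two denominators that occur here the conjugates `R ± 5/4 b`, where `R = shiftedSq x + 5/8` and `b =
x_i`. -/
theorem edgeRatio_weight_ge {d : ℕ} (i : Fin d) (x : Fin d → ℤ) :
    (2 * (shiftedSq x + 5 / 8) - 29 / 5 * (x i : ℝ) ^ 2) / (4 * (shiftedSq x + 5 / 8) ^ 2) ≤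
      1 - edgeRatio i x + (1 - (edgeRatio i (x - Pi.single i 1))⁻¹) := by
  have h := sq_add_ten_le_shiftedSq x i
  unfold edgeRatio
  rw [shiftedSq_sub_single]
  simp only [Pi.sub_apply, Pi.single_eq_same, Int.cast_sub, Int.cast_one, inv_div]
  generalize (x i : ℝ) = b at *
  obtain ⟨R, hR⟩ : ∃ R, R = shiftedSq x + 5 / 8 := ⟨_, rfl⟩
  rw [← hR]
  have hx : shiftedSq x = R - 5 / 8 := by linarith
  rw [hx] at h ⊢
  have h1 : 0 < R + 5 / 4 * b := by nlinarith [sq_nonneg (b + 1)]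
  have h2 : 0 < R - 5 / 4 * b := by nlinarith [sq_nonneg (b - 1)]
  have h0 : 0 < R := by nlinarith [sq_nonneg b]
  have e1 : R - 5 / 8 + 5 / 4 * b + 5 / 8 = R + 5 / 4 * b := by ring
  have e2 : R - 5 / 8 - 2 * b + 1 + 3 / 4 * (b - 1) + 3 / 8 = R - 5 / 4 * b := by ring
  rw [e1, e2]
  have e3 : 1 - (R - 5 / 8 + 3 / 4 * b + 3 / 8) / (R + 5 / 4 * b) +
      (1 - (R - 5 / 8 - 2 * b + 1 + 5 / 4 * (b - 1) + 5 / 8) / (R - 5 / 4 * b)) =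
      (2 * R - 5 * b ^ 2) / (4 * ((R + 5 / 4 * b) * (R - 5 / 4 * b))) := by
    rw [one_sub_div h1.ne', one_sub_div h2.ne', div_add_div _ _ h1.ne' h2.ne',
      div_eq_div_iff (by positivity) (by positivity)]
    ring
  rw [e3, div_le_div_iff₀ (by positivity) (by positivity)]
  -- The gap between `5` and `29 / 5` pays for enlarging the denominator to `4 R²`; the constant
  -- `10` in `shiftedSq` makes this suffice for small `b` too.
  have h3 : 0 ≤ b ^ 2 * (4 / 5 * R ^ 2 + 25 / 8 * R - 145 / 16 * b ^ 2) := by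
    apply mul_nonneg (sq_nonneg b)
    nlinarith [sq_nonneg b]
  nlinarith

/-- Summation over `i` turns the numerators into at least `2 d R - 29/5 R`. The dimension enters
through `2 d ≥ 6 > 29/5`, which leaves `R / 5` over `4 R²`. -/
theorem sum_edgeRatio_weight_ge {d : ℕ} (hd : 3 ≤ d) (x : Fin d → ℤ) :
    1 / (20 * (shiftedSq x + 5 / 8)) ≤
      ∑ i, (1 - edgeRatio i x + (1 - (edgeRatio i (x - Pi.single i 1))⁻¹)) := by
  refine le_trans ?_ (Finset.sum_le_sum fun i _ => edgeRatio_weight_ge i x)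
  have hd' : (3 : ℝ) ≤ d := by exact_mod_cast hd
  have h0 : 0 ≤ ∑ i, (x i : ℝ) ^ 2 := Finset.sum_nonneg fun i _ => sq_nonneg _
  have h1 : ∑ i, (x i : ℝ) ^ 2 = shiftedSq x - 10 := by unfold shiftedSq; ring
  rw [h1] at h0
  rw [← Finset.sum_div, Finset.sum_sub_distrib, ← Finset.mul_sum, ← Finset.mul_sum, h1,
    Finset.sum_const, Finset.card_univ, Fintype.card_fin, nsmul_eq_mul]
  have h2 : 0 < shiftedSq x + 5 / 8 := by linarith
  rw [div_le_div_iff₀ (by positivity) (by positivity)]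
  have h3 : 3 * (2 * (shiftedSq x + 5 / 8)) ≤ d * (2 * (shiftedSq x + 5 / 8)) := by gcongr
  nlinarith

/-- In dimension at least three, the capacity of the origin is positive. -/
theorem sq_apply_zero_le {d : ℕ} (hd : 3 ≤ d) {F : (Fin d → ℤ) → ℝ} (hF : F.support.Finite) :
    F 0 ^ 2 ≤ 213 * ∑ i, ∑' x, (F (x + Pi.single i 1) - F x) ^ 2 := by
  have hF2 : (fun x => F x ^ 2).support.Finite :=
    hF.subset fun x hx => by contrapose! hx; simp_all
  have h1 : ∑' x, (∑ i, (1 - edgeRatio i x + (1 - (edgeRatio i (x - Pi.single i 1))⁻¹))) *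
      F x ^ 2 ≤ ∑ i, ∑' x, (F (x + Pi.single i 1) - F x) ^ 2 := by
    simp_rw [Finset.sum_mul]
    rw [Summable.tsum_finsetSum fun i _ => summable_mul_of_finite_support hF2 _]
    exact Finset.sum_le_sum fun i _ => tsum_edge_weight_mul_sq_le hF (edgeRatio_pos i) _
  have h2 := (summable_mul_of_finite_support hF2 _).le_tsum (f := fun x => (∑ i,
    (1 - edgeRatio i x + (1 - (edgeRatio i (x - Pi.single i 1))⁻¹))) * F x ^ 2) 0 fun x _ => by
      refine mul_nonneg (le_trans ?_ (sum_edgeRatio_weight_ge hd x)) (sq_nonneg _)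
      have : 0 ≤ shiftedSq x := by unfold shiftedSq; positivity
      positivity
  have h3 := mul_le_mul_of_nonneg_right (sum_edgeRatio_weight_ge hd 0) (sq_nonneg (F 0))
  have h4 : shiftedSq (0 : Fin d → ℤ) = 10 := by simp [shiftedSq]
  rw [h4] at h3
  have h5 := h3.trans (h2.trans h1)
  -- The weight at the origin is at least `1 / (20 * (10 + 5/8)) = 1 / 212.5`, whence `213`.
  nlinarith [sq_nonneg (F 0)]

end Hardy

/-! ### Logarithmic cutoffs in dimension at most two. -/

section Cutoff

variable {d : ℕ}

/-- The sup norm on `ℤ^d`. -/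
noncomputable def supNat (x : Fin d → ℤ) : ℕ :=
  Finset.univ.sup fun i => (x i).natAbs

theorem supNat_le_iff {x : Fin d → ℤ} {n : ℕ} : supNat x ≤ n ↔ ∀ i, (x i).natAbs ≤ n := by
  simp [supNat]

theorem supNat_add_le (x y : Fin d → ℤ) : supNat (x + y) ≤ supNat x + supNat y :=
  supNat_le_iff.2 fun i => (Int.natAbs_add_le _ _).trans
    (add_le_add (supNat_le_iff.1 le_rfl i) (supNat_le_iff.1 le_rfl i))

theorem supNat_single_le (i : Fin d) : supNat (Pi.single i 1 : Fin d → ℤ) ≤ 1 :=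
  supNat_le_iff.2 fun j => by
    by_cases h : j = i
    · subst h; simp
    · simp [Pi.single_eq_of_ne h]

theorem supNat_neg (x : Fin d → ℤ) : supNat (-x) = supNat x := by simp [supNat]

theorem supNat_add_single_le (x : Fin d → ℤ) (i : Fin d) :
    supNat (x + Pi.single i 1) ≤ supNat x + 1 :=
  (supNat_add_le _ _).trans (Nat.add_le_add_left (supNat_single_le i) _)

theorem supNat_le_add_single (x : Fin d → ℤ) (i : Fin d) :
    supNat x ≤ supNat (x + Pi.single i 1) + 1 := by
  have h := supNat_add_le (x + Pi.single i 1) (-Pi.single i 1)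
  rw [add_neg_cancel_right, supNat_neg] at h
  exact h.trans (Nat.add_le_add_left (supNat_single_le i) _)

/-- The box of radius `n`. -/
noncomputable def latticeBox (d n : ℕ) : Finset (Fin d → ℤ) :=
  Fintype.piFinset fun _ => Finset.Icc (-n : ℤ) n

theorem mem_latticeBox {n : ℕ} {x : Fin d → ℤ} : x ∈ latticeBox d n ↔ supNat x ≤ n := by
  simp only [latticeBox, Fintype.mem_piFinset, Finset.mem_Icc, supNat_le_iff]
  exact forall_congr' fun i => by omega

theorem card_latticeBox (d n : ℕ) : (latticeBox d n).card = (2 * n + 1) ^ d := by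
  simp only [latticeBox, Fintype.card_piFinset, Int.card_Icc, Finset.prod_const,
    Finset.card_univ, Fintype.card_fin]
  congr 1
  omega

/-- The partial sums of the harmonic series. -/
noncomputable def harmonicSum (n : ℕ) : ℝ := ∑ j ∈ Finset.range n, 1 / ((j : ℝ) + 1)

theorem harmonicSum_succ (n : ℕ) : harmonicSum (n + 1) = harmonicSum n + 1 / ((n : ℝ) + 1) :=
  Finset.sum_range_succ _ _

theorem harmonicSum_mono : Monotone harmonicSum :=
  monotone_nat_of_le_succ fun n => by
    rw [harmonicSum_succ]
    have : 0 ≤ 1 / ((n : ℝ) + 1) := by positivity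
    linarith

theorem one_le_harmonicSum_succ (n : ℕ) : 1 ≤ harmonicSum (n + 1) := by
  have h := harmonicSum_mono (Nat.succ_le_succ n.zero_le)
  simpa [harmonicSum] using h

theorem abs_harmonicSum_sub_le {k l : ℕ} (h1 : l ≤ k + 1) (h2 : k ≤ l + 1) :
    |harmonicSum l - harmonicSum k| ≤ 2 / ((k : ℝ) + 1) := by
  obtain rfl | rfl | rfl : l = k + 1 ∨ l = k ∨ k = l + 1 := by omega
  · rw [harmonicSum_succ, add_sub_cancel_left, abs_of_nonneg (by positivity)]
    gcongr
    norm_num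
  · rw [sub_self, abs_zero]
    positivity
  · rw [harmonicSum_succ, abs_sub_comm, add_sub_cancel_left, abs_of_nonneg (by positivity),
      div_le_div_iff₀ (by positivity) (by positivity)]
    push_cast
    linarith [(Nat.cast_nonneg l : (0 : ℝ) ≤ l)]

/-- For `d ≤ 2` the sup-norm sphere of radius `n + 1` has at most `8 (n + 2)` points, so it
contributes at most `8 / (n + 2)`, a multiple of a harmonic term. -/
theorem sum_latticeBox_le (hd : d ≤ 2) (n : ℕ) :
    ∑ x ∈ latticeBox d n, 1 / ((supNat x : ℝ) + 1) ^ 2 ≤ 8 * harmonicSum (n + 1) := by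
  induction n with
  | zero =>
    have h : ∑ x ∈ latticeBox d 0, 1 / ((supNat x : ℝ) + 1) ^ 2 ≤ (latticeBox d 0).card • 1 :=
      Finset.sum_le_card_nsmul _ _ _ fun x _ =>
        div_le_one_of_le₀ (one_le_pow₀ (by simp)) (by positivity)
    rw [card_latticeBox] at h
    have := one_le_harmonicSum_succ 0
    simp only [mul_zero, zero_add, one_pow, one_smul] at h
    linarith
  | succ n ih =>
    have hsub : latticeBox d n ⊆ latticeBox d (n + 1) := fun x hx =>
      mem_latticeBox.2 ((mem_latticeBox.1 hx).trans n.le_succ)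
    rw [← Finset.sum_sdiff hsub]
    have hcard : ((latticeBox d (n + 1) \ latticeBox d n).card : ℝ) ≤ 8 * (n + 2) := by
      rw [Finset.cast_card_sdiff hsub, card_latticeBox, card_latticeBox]
      push_cast
      have : (0 : ℝ) ≤ n := n.cast_nonneg
      interval_cases d
      · norm_num; linarith
      · norm_num; linarith
      · nlinarith
    have h1 : ∑ x ∈ latticeBox d (n + 1) \ latticeBox d n, 1 / ((supNat x : ℝ) + 1) ^ 2 ≤
        8 * (1 / ((n : ℝ) + 2)) := by
      have h2 : ∀ x ∈ latticeBox d (n + 1) \ latticeBox d n,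
          1 / ((supNat x : ℝ) + 1) ^ 2 = 1 / ((n : ℝ) + 2) ^ 2 := by
        intro x hx
        rw [Finset.mem_sdiff, mem_latticeBox, mem_latticeBox] at hx
        have : supNat x = n + 1 := by omega
        rw [this]
        push_cast
        ring
      rw [Finset.sum_congr rfl h2, Finset.sum_const, nsmul_eq_mul]
      calc _ ≤ 8 * ((n : ℝ) + 2) * (1 / ((n : ℝ) + 2) ^ 2) := by gcongr
        _ = _ := by field_simp
    rw [harmonicSum_succ (n + 1)]
    push_cast
    rw [add_assoc (n : ℝ), one_add_one_eq_two]
    linarith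

/-- A logarithmic cutoff function. -/
noncomputable def logCutoff (d n : ℕ) (x : Fin d → ℤ) : ℝ :=
  max 0 (1 - harmonicSum (supNat x) / harmonicSum (n + 1))

theorem logCutoff_eq_zero {n : ℕ} {x : Fin d → ℤ} (h : n < supNat x) : logCutoff d n x = 0 := by
  have h0 := one_le_harmonicSum_succ n
  refine max_eq_left ?_
  rw [sub_nonpos, one_le_div (by linarith)]
  exact harmonicSum_mono h

theorem logCutoff_support_subset (n : ℕ) : (logCutoff d n).support ⊆ latticeBox d n := by
  intro x hx
  rw [Finset.mem_coe, mem_latticeBox]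
  by_contra! h
  exact hx (logCutoff_eq_zero h)

theorem logCutoff_zero (n : ℕ) : logCutoff d n 0 = 1 := by
  have h : supNat (0 : Fin d → ℤ) = 0 := Nat.le_zero.1 (supNat_le_iff.2 fun i => by simp)
  simp [logCutoff, h, harmonicSum]

theorem logCutoff_sub_sq_le (n : ℕ) (x : Fin d → ℤ) (i : Fin d) :
    (logCutoff d n (x + Pi.single i 1) - logCutoff d n x) ^ 2 ≤
      4 / harmonicSum (n + 1) ^ 2 * (1 / ((supNat x : ℝ) + 1) ^ 2) := by
  have h0 := one_le_harmonicSum_succ n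
  have h1 : |logCutoff d n (x + Pi.single i 1) - logCutoff d n x| ≤
      2 / ((supNat x : ℝ) + 1) / harmonicSum (n + 1) := by
    calc _ ≤ |(1 - harmonicSum (supNat (x + Pi.single i 1)) / harmonicSum (n + 1)) -
          (1 - harmonicSum (supNat x) / harmonicSum (n + 1))| := by
          simpa only [logCutoff, max_comm (0 : ℝ)] using abs_max_sub_max_le_abs _ _ (0 : ℝ)
      _ = |harmonicSum (supNat (x + Pi.single i 1)) - harmonicSum (supNat x)| /
          harmonicSum (n + 1) := by
          rw [sub_sub_sub_cancel_left, ← sub_div, abs_div, abs_sub_comm,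
            abs_of_pos (zero_lt_one.trans_le h0)]
      _ ≤ _ := by
          gcongr
          exact abs_harmonicSum_sub_le (supNat_add_single_le x i) (supNat_le_add_single x i)
  calc _ = |logCutoff d n (x + Pi.single i 1) - logCutoff d n x| ^ 2 := (sq_abs _).symm
    _ ≤ (2 / ((supNat x : ℝ) + 1) / harmonicSum (n + 1)) ^ 2 := by gcongr
    _ = _ := by
        have : harmonicSum (n + 1) ≠ 0 := by linarith
        field_simp
        norm_num

theorem tsum_logCutoff_le (hd : d ≤ 2) (n : ℕ) (i : Fin d) :
    ∑' x, (logCutoff d n (x + Pi.single i 1) - logCutoff d n x) ^ 2 ≤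
      64 / harmonicSum (n + 1) := by
  have h0 := one_le_harmonicSum_succ n
  -- Radius `n + 1` and not `n`, because edges leaving the support of the cutoff may start just
  -- outside it.
  rw [tsum_eq_sum (s := latticeBox d (n + 1))]
  · calc _ ≤ ∑ x ∈ latticeBox d (n + 1),
          4 / harmonicSum (n + 1) ^ 2 * (1 / ((supNat x : ℝ) + 1) ^ 2) :=
          Finset.sum_le_sum fun x _ => logCutoff_sub_sq_le n x i
      _ ≤ 4 / harmonicSum (n + 1) ^ 2 * (8 * harmonicSum (n + 2)) := by
          rw [← Finset.mul_sum]
          gcongr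
          exact sum_latticeBox_le hd (n + 1)
      _ ≤ 4 / harmonicSum (n + 1) ^ 2 * (8 * (2 * harmonicSum (n + 1))) := by
          gcongr
          rw [harmonicSum_succ (n + 1)]
          have : 1 / (((n + 1 : ℕ) : ℝ) + 1) ≤ 1 :=
            div_le_one_of_le₀ (by push_cast; linarith [n.cast_nonneg (α := ℝ)]) (by positivity)
          linarith
      _ = _ := by
          have : harmonicSum (n + 1) ≠ 0 := by linarith
          field_simp
          norm_num
  · intro x hx
    rw [mem_latticeBox, not_le] at hx
    have := supNat_le_add_single x i
    rw [logCutoff_eq_zero (by omega), logCutoff_eq_zero (by omega)]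
    simp

/-- In dimension at most two, the capacity of the origin vanishes. -/
theorem exists_cutoff (hd : d ≤ 2) {ε : ℝ} (hε : 0 < ε) :
    ∃ g : (Fin d → ℤ) → ℝ, g.support.Finite ∧ g 0 = 1 ∧
      ∀ i, ∑' x, (g (x + Pi.single i 1) - g x) ^ 2 ≤ ε := by
  have ht : Filter.Tendsto harmonicSum Filter.atTop Filter.atTop :=
    Real.tendsto_sum_range_one_div_nat_succ_atTop
  obtain ⟨n, hn⟩ := ((ht.comp (Filter.tendsto_add_atTop_nat 1)).eventually_ge_atTop
    (64 / ε)).exists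
  refine ⟨logCutoff d n, (latticeBox d n).finite_toSet.subset (logCutoff_support_subset n),
    logCutoff_zero n, fun i => (tsum_logCutoff_le hd n i).trans ?_⟩
  have h0 := one_le_harmonicSum_succ n
  rw [Function.comp_apply, div_le_iff₀ hε] at hn
  rw [div_le_iff₀ (by linarith)]
  linarith

end Cutoff

/-! ### Steps and avoidance probabilities. -/

/-- The possible steps of the walk: `none` is staying put. -/
abbrev WalkStep (d : ℕ) := Option (Fin d × Bool)

/-- The displacement of a step. -/
def WalkStep.vec {d : ℕ} : WalkStep d → Fin d → ℤ
  | none => 0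
  | some (i, true) => Pi.single i 1
  | some (i, false) => -Pi.single i 1

/-- The probability of a step from a given site. -/
def WalkStep.prob {d : ℕ} (a : Fin d → ℤ → ℝ) (x : Fin d → ℤ) : WalkStep d → ℝ
  | none => 1 - 2 * ∑ i, a i (x i)
  | some (i, _) => a i (x i)

/-- The probability that the walk started at `x` is not at the origin at the times `1, …, n`. -/
def avoidProb {d : ℕ} (a : Fin d → ℤ → ℝ) : ℕ → (Fin d → ℤ) → ℝ
  | 0, _ => 1
  | n + 1, x => ∑ s : WalkStep d, WalkStep.prob a x s *
      if x + s.vec = 0 then 0 else avoidProb a n (x + s.vec)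

theorem WalkStep.vec_injective (d : ℕ) : Function.Injective (WalkStep.vec (d := d)) := by
  have hne : ∀ (i j : Fin d), (Pi.single i 1 : Fin d → ℤ) ≠ -Pi.single j 1 := by
    intro i j h
    have h1 := congrFun h i
    by_cases hij : i = j
    · subst hij; simp at h1
    · simp [Pi.single_eq_of_ne hij] at h1
  have hinj : ∀ (i j : Fin d), (Pi.single i 1 : Fin d → ℤ) = Pi.single j 1 → i = j := by
    intro i j h
    by_contra hij
    have h1 := congrFun h i
    simp [Pi.single_eq_of_ne hij] at h1
  rintro (_ | ⟨i, _ | _⟩) (_ | ⟨j, _ | _⟩) h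
  · rfl
  · simp [vec, eq_comm] at h
  · simp [vec, eq_comm] at h
  · simp [vec] at h
  · rw [hinj i j (neg_injective h)]
  · exact absurd h.symm (hne j i)
  · simp [vec] at h
  · exact absurd h (hne i j)
  · rw [hinj i j h]

theorem WalkStep.sum_prob {d : ℕ} (a : Fin d → ℤ → ℝ) (x : Fin d → ℤ) :
    ∑ s, WalkStep.prob a x s = 1 := by
  simp [Fintype.sum_option, Fintype.sum_prod_type, prob, ← Finset.mul_sum, ← two_mul]

/-- The law of total probability: `H` takes countably many values, so a common conditional
probability `w` on its fibres survives summation over them. -/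
theorem measureReal_preimage_inter_of_forall_singleton {Ω β : Type*} [MeasurableSpace Ω]
    {P : Measure Ω} [IsFiniteMeasure P] [Countable β] [MeasurableSpace β]
    [MeasurableSingletonClass β] {H : Ω → β} (hH : Measurable H) {E : Set Ω}
    (hE : MeasurableSet E) (A : Set β) {w : ℝ} (hw : 0 ≤ w)
    (h : ∀ y ∈ A, P.real (H ⁻¹' {y} ∩ E) = w * P.real (H ⁻¹' {y})) :
    P.real (H ⁻¹' A ∩ E) = w * P.real (H ⁻¹' A) := by
  have h' : ∀ y ∈ A, P (H ⁻¹' {y} ∩ E) = ENNReal.ofReal w * P (H ⁻¹' {y}) := by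
    intro y hy
    rw [← ofReal_measureReal (s := H ⁻¹' {y} ∩ E), h y hy, ENNReal.ofReal_mul hw,
      ofReal_measureReal]
  have hA : H ⁻¹' A = ⋃ y ∈ A, H ⁻¹' {y} := by ext; simp
  have hAE : H ⁻¹' A ∩ E = ⋃ y ∈ A, H ⁻¹' {y} ∩ E := by ext; simp
  have hd : A.PairwiseDisjoint fun y => H ⁻¹' {y} := fun x _ y _ hxy =>
    Disjoint.preimage H (by simpa using hxy)
  have hm : ∀ y, MeasurableSet (H ⁻¹' {y}) := fun y => hH (measurableSet_singleton y)
  have : P (H ⁻¹' A ∩ E) = ENNReal.ofReal w * P (H ⁻¹' A) := by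
    rw [hAE, hA, measure_biUnion A.to_countable
      (hd.mono fun y => Set.inter_subset_left) fun y _ => (hm y).inter hE,
      measure_biUnion A.to_countable hd fun y _ => hm y, ← ENNReal.tsum_mul_left]
    exact tsum_congr fun y => h' y y.2
  rw [measureReal_def, this, ENNReal.toReal_mul, ENNReal.toReal_ofReal hw, measureReal_def]

/-! ### Markov property, last-visit decomposition, criteria for recurrence and transience. -/

section Walk

variable {Ω : Type*} [MeasurableSpace Ω] {P : Measure Ω} {d : ℕ} {a : Fin d → ℤ → ℝ}
  {S : ℕ → Ω → Fin d → ℤ}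

theorem IsLazyWalk.measurableSet_eq (hS : IsLazyWalk P a S) (t : ℕ) (x : Fin d → ℤ) :
    MeasurableSet {ω | S t ω = x} :=
  hS.measurable t (measurableSet_singleton x)

theorem IsLazyWalk.measurableSet_history (hS : IsLazyWalk P a S) (t : ℕ) (x : ℕ → Fin d → ℤ) :
    MeasurableSet {ω | ∀ s ≤ t, S s ω = x s} := by
  simp only [Set.ofPred_forall]
  exact .iInter fun s => .iInter fun _ => hS.measurableSet_eq s _

theorem IsLazyWalk.measurableSet_step (hS : IsLazyWalk P a S) (t : ℕ) (s : WalkStep d) :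
    MeasurableSet {ω | S (t + 1) ω = S t ω + s.vec} :=
  measurableSet_eq_fun (hS.measurable _) ((hS.measurable t).add_const _)

theorem IsLazyWalk.measurableSet_avoid (hS : IsLazyWalk P a S) (t n : ℕ) :
    MeasurableSet {ω | ∀ k, t < k → k ≤ t + n → S k ω ≠ 0} := by
  simp only [Set.ofPred_forall]
  exact .iInter fun k => .iInter fun _ => .iInter fun _ => (hS.measurableSet_eq k 0).compl

theorem IsLazyWalk.history_step (hS : IsLazyWalk P a S) (t : ℕ) (x : ℕ → Fin d → ℤ)
    (s : WalkStep d) :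
    P.real ({ω | ∀ s ≤ t, S s ω = x s} ∩ {ω | S (t + 1) ω = S t ω + s.vec}) =
      WalkStep.prob a (x t) s * P.real {ω | ∀ s ≤ t, S s ω = x s} := by
  have : {ω | ∀ s ≤ t, S s ω = x s} ∩ {ω | S (t + 1) ω = S t ω + s.vec} =
      {ω | (∀ s ≤ t, S s ω = x s) ∧ S (t + 1) ω = x t + s.vec} := by
    ext ω
    simp only [Set.mem_inter_iff, Set.mem_ofPred_eq]
    exact and_congr_right fun h => by rw [h t le_rfl]
  rw [this]
  obtain _ | ⟨i, _ | _⟩ := s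
  · simpa [WalkStep.vec, WalkStep.prob] using hS.stay t x
  · simpa [WalkStep.vec, WalkStep.prob, sub_eq_add_neg] using hS.step_down t x i
  · exact hS.step_up t x i

variable [IsProbabilityMeasure P]

/-- Passes from conditioning on a whole history to conditioning on the present position, by summing
over the countably many histories up to time `t`. -/
theorem IsLazyWalk.of_history (hS : IsLazyWalk P a S) (t : ℕ) (A : Set (Fin d → ℤ)) {E : Set Ω}
    (hE : MeasurableSet E) {w : ℝ} (hw : 0 ≤ w)
    (h : ∀ x : ℕ → Fin d → ℤ, x t ∈ A → P.real ({ω | ∀ s ≤ t, S s ω = x s} ∩ E) =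
      w * P.real {ω | ∀ s ≤ t, S s ω = x s}) :
    P.real ({ω | S t ω ∈ A} ∩ E) = w * P.real {ω | S t ω ∈ A} := by
  refine measureReal_preimage_inter_of_forall_singleton
    (H := fun ω (s : Fin (t + 1)) => S s ω)
    (measurable_pi_lambda _ fun s => hS.measurable s) hE {y | y (Fin.last t) ∈ A} hw ?_
  intro y hy
  have hy' : (fun ω (s : Fin (t + 1)) => S s ω) ⁻¹' {y} = {ω | ∀ s ≤ t, S s ω =
      (fun s : ℕ => if h : s < t + 1 then y ⟨s, h⟩ else 0) s} := by
    ext ω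
    simp only [Set.mem_preimage, Set.mem_singleton_iff, Set.mem_ofPred_eq]
    constructor
    · intro h s hs
      rw [dif_pos (Nat.lt_succ_of_le hs), ← h]
    · intro h
      ext1 s
      rw [h s (Nat.le_of_lt_succ s.2), dif_pos s.2]
  rw [hy']
  refine h _ ?_
  simpa [Fin.last] using hy

/-- The steps have distinct displacements, so the corresponding events are disjoint, and their
probabilities add up to one. -/
theorem IsLazyWalk.ae_step (hS : IsLazyWalk P a S) (t : ℕ) :
    ∀ᵐ ω ∂P, ∃ s : WalkStep d, S (t + 1) ω = S t ω + s.vec := by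
  have hd : Pairwise (Function.onFun Disjoint
      fun s : WalkStep d => {ω | S (t + 1) ω = S t ω + s.vec}) := by
    intro s s' hss
    refine Set.disjoint_left.2 fun ω h1 h2 => hss (WalkStep.vec_injective d ?_)
    exact add_left_cancel (h1.symm.trans h2)
  have hm : MeasurableSet (⋃ s : WalkStep d, {ω | S (t + 1) ω = S t ω + s.vec}) :=
    .iUnion fun s => hS.measurableSet_step t s
  have h := hS.of_history t Set.univ hm zero_le_one fun x _ => by
    rw [Set.inter_iUnion, measureReal_iUnion_fintype
      (fun i j hij => (hd hij).mono Set.inter_subset_right Set.inter_subset_right)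
      fun s => (hS.measurableSet_history t x).inter (hS.measurableSet_step t s)]
    simp_rw [hS.history_step]
    rw [← Finset.sum_mul, WalkStep.sum_prob]
  simp only [Set.mem_univ, Set.ofPred_true, Set.univ_inter, probReal_univ, mul_one] at h
  have h2 : P (⋃ s : WalkStep d, {ω | S (t + 1) ω = S t ω + s.vec}) = 1 := by
    rw [← ofReal_measureReal, h, ENNReal.ofReal_one]
  have h3 := (prob_compl_eq_zero_iff hm).2 h2
  filter_upwards [compl_mem_ae_iff.2 h3] with ω hω
  simpa using hω

theorem IsLazyWalk.measureReal_eq_sum_step (hS : IsLazyWalk P a S) (t : ℕ) {E : Set Ω}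
    (hE : MeasurableSet E) :
    P.real E = ∑ s : WalkStep d, P.real (E ∩ {ω | S (t + 1) ω = S t ω + s.vec}) := by
  rw [← measureReal_iUnion_fintype ?_ fun s => hE.inter (hS.measurableSet_step t s),
    ← Set.inter_iUnion]
  · refine measureReal_congr ?_
    filter_upwards [hS.ae_step t] with ω hω
    refine propext ⟨fun h => ⟨h, by simpa using hω⟩, fun h => h.1⟩
  · intro s s' hss
    refine Set.disjoint_left.2 fun ω h1 h2 => hss (WalkStep.vec_injective d ?_)
    exact add_left_cancel (h1.2.symm.trans h2.2)

theorem IsLazyWalk.point_step (hS : IsLazyWalk P a S) (t : ℕ) (x : Fin d → ℤ) (s : WalkStep d)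
    (hs : 0 ≤ WalkStep.prob a x s) :
    P.real ({ω | S t ω = x} ∩ {ω | S (t + 1) ω = S t ω + s.vec}) =
      WalkStep.prob a x s * P.real {ω | S t ω = x} :=
  hS.of_history t {x} (hS.measurableSet_step t s) hs fun y hy => by
    rw [hS.history_step, Set.mem_singleton_iff.1 hy]

theorem IsLazyWalk.measureReal_succ (hS : IsLazyWalk P a S)
    (ha : ∀ x s, 0 ≤ WalkStep.prob a x s) (t : ℕ) (x : Fin d → ℤ) :
    P.real {ω | S (t + 1) ω = x} = ∑ s : WalkStep d,
      WalkStep.prob a (x - s.vec) s * P.real {ω | S t ω = x - s.vec} := by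
  rw [hS.measureReal_eq_sum_step t (hS.measurableSet_eq _ _)]
  refine Finset.sum_congr rfl fun s _ => ?_
  rw [← hS.point_step _ _ _ (ha _ s)]
  congr 1
  ext ω
  simp only [Set.mem_inter_iff, Set.mem_ofPred_eq]
  constructor
  · rintro ⟨rfl, h⟩
    exact ⟨by simp [h], h⟩
  · rintro ⟨h, h'⟩
    exact ⟨by simp [h', h], h'⟩

theorem avoidProb_nonneg (ha : ∀ x s, 0 ≤ WalkStep.prob a x s) (n : ℕ) (x : Fin d → ℤ) :
    0 ≤ avoidProb a n x := by
  induction n generalizing x with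
  | zero => exact zero_le_one
  | succ n ih =>
    refine Finset.sum_nonneg fun s _ => mul_nonneg (ha x s) ?_
    split_ifs
    exacts [le_rfl, ih _]

/-- The Markov property for avoiding the origin, by induction on `n`: condition on the next step and
absorb it into the history. -/
theorem IsLazyWalk.history_avoid (hS : IsLazyWalk P a S) (n t : ℕ) (x : ℕ → Fin d → ℤ) :
    P.real ({ω | ∀ s ≤ t, S s ω = x s} ∩ {ω | ∀ k, t < k → k ≤ t + n → S k ω ≠ 0}) =
      avoidProb a n (x t) * P.real {ω | ∀ s ≤ t, S s ω = x s} := by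
  induction n generalizing t x with
  | zero =>
    rw [avoidProb, one_mul]
    congr 1
    ext ω
    simp only [Set.mem_inter_iff, Set.mem_ofPred_eq, and_iff_left_iff_imp]
    intro _ k hk hk'
    omega
  | succ n ih =>
    rw [hS.measureReal_eq_sum_step t
      ((hS.measurableSet_history t x).inter (hS.measurableSet_avoid t _)), avoidProb,
      Finset.sum_mul]
    refine Finset.sum_congr rfl fun s _ => ?_
    split_ifs with h0
    · rw [mul_zero, zero_mul]
      convert measureReal_empty
      ext ω
      simp only [Set.mem_inter_iff, Set.mem_ofPred_eq, Set.mem_empty_iff_false, iff_false]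
      rintro ⟨⟨h1, h2⟩, h3⟩
      refine h2 (t + 1) (by omega) (by omega) ?_
      rw [h3, h1 t le_rfl, h0]
    -- Updating `x` at time `t + 1` records the step, so that the induction hypothesis applies to
    -- the longer history.
    · have hx : Function.update x (t + 1) (x t + s.vec) (t + 1) = x t + s.vec := by simp
      have hist : {ω | ∀ k ≤ t + 1, S k ω = Function.update x (t + 1) (x t + s.vec) k} =
          {ω | ∀ k ≤ t, S k ω = x k} ∩ {ω | S (t + 1) ω = S t ω + s.vec} := by
        ext ω
        simp only [Set.mem_inter_iff, Set.mem_ofPred_eq]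
        constructor
        · intro h
          have h1 : ∀ k ≤ t, S k ω = x k := fun k hk => by
            rw [h k (by omega), Function.update_of_ne (by omega)]
          exact ⟨h1, by rw [h _ le_rfl, hx, h1 t le_rfl]⟩
        · rintro ⟨h1, h2⟩ k hk
          obtain rfl | hk := hk.eq_or_lt
          · rw [h2, hx, h1 t le_rfl]
          · rw [h1 k (by omega), Function.update_of_ne (by omega)]
      have h := ih (t + 1) (Function.update x (t + 1) (x t + s.vec))
      rw [hx, hist, hS.history_step] at h
      rw [mul_comm (WalkStep.prob _ _ _), mul_assoc, ← h]
      congr 1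
      ext ω
      simp only [Set.mem_inter_iff, Set.mem_ofPred_eq]
      constructor
      · rintro ⟨⟨h1, h2⟩, h3⟩
        exact ⟨⟨h1, h3⟩, fun k hk hk' => h2 k (by omega) (by omega)⟩
      · rintro ⟨⟨h1, h3⟩, h2⟩
        refine ⟨⟨h1, fun k hk hk' => ?_⟩, h3⟩
        obtain rfl | hk := (Nat.succ_le_of_lt hk).eq_or_lt
        · rwa [Nat.succ_eq_add_one, h3, h1 t le_rfl]
        · exact h2 k hk (by omega)

theorem IsLazyWalk.origin_avoid (hS : IsLazyWalk P a S) (ha : ∀ x s, 0 ≤ WalkStep.prob a x s)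
    (n t : ℕ) :
    P.real ({ω | S t ω = 0} ∩ {ω | ∀ k, t < k → k ≤ t + n → S k ω ≠ 0}) =
      avoidProb a n 0 * P.real {ω | S t ω = 0} :=
  hS.of_history t {0} (hS.measurableSet_avoid t n) (avoidProb_nonneg ha n 0) fun y hy => by
    rw [hS.history_avoid, Set.mem_singleton_iff.1 hy]

/-- Decomposition according to the last visit of the origin before time `T`. -/
theorem IsLazyWalk.avoidProb_mul_sum_le (hS : IsLazyWalk P a S)
    (ha : ∀ x s, 0 ≤ WalkStep.prob a x s) (T : ℕ) :
    avoidProb a T 0 * ∑ t ∈ Finset.range T, P.real {ω | S t ω = 0} ≤ 1 := by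
  rw [Finset.mul_sum]
  simp_rw [← hS.origin_avoid ha]
  rw [← measureReal_biUnion_finset ?_ fun t _ =>
    (hS.measurableSet_eq t 0).inter (hS.measurableSet_avoid t T)]
  · exact measureReal_le_one
  · intro t ht t' ht' hne
    simp only [Finset.coe_range, Set.mem_Iio] at ht ht'
    refine Set.disjoint_left.2 fun ω h h' => ?_
    obtain hlt | hlt := hne.lt_or_gt
    · exact h.2 t' hlt (by omega) h'.1
    · exact h'.2 t hlt (by omega) h.1

/-- By the last-visit decomposition, an unbounded expected number of visits makes the probability of
avoiding the origin for `T` steps arbitrarily small. Hence almost surely no visit is the last, and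
the visit at time `0` starts an infinite chain. -/
theorem IsLazyWalk.isRecurrentWalk (hS : IsLazyWalk P a S)
    (ha : ∀ x s, 0 ≤ WalkStep.prob a x s)
    (h : ¬ ∃ K, ∀ T, ∑ t ∈ Finset.range T, P.real {ω | S t ω = 0} ≤ K) :
    IsRecurrentWalk P S := by
  have hL : ∀ t, ∀ᵐ ω ∂P, S t ω = 0 → ∃ k, t < k ∧ S k ω = 0 := by
    intro t
    have h0 : P.real {ω | S t ω = 0 ∧ ∀ k, t < k → S k ω ≠ 0} = 0 := by
      refine le_antisymm (le_of_forall_pos_le_add fun ε hε => ?_) measureReal_nonneg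
      push Not at h
      obtain ⟨T, hT⟩ := h ε⁻¹
      have h1 := hS.avoidProb_mul_sum_le ha T
      have h2 := avoidProb_nonneg ha T (0 : Fin d → ℤ)
      have h3 : avoidProb a T 0 ≤ ε := by
        have h4 : avoidProb a T 0 * ε⁻¹ ≤ 1 :=
          (mul_le_mul_of_nonneg_left hT.le h2).trans h1
        rwa [← div_eq_mul_inv, div_le_one hε] at h4
      calc _ ≤ P.real ({ω | S t ω = 0} ∩ {ω | ∀ k, t < k → k ≤ t + T → S k ω ≠ 0}) :=
            measureReal_mono fun ω hω => ⟨hω.1, fun k hk _ => hω.2 k hk⟩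
        _ = avoidProb a T 0 * P.real {ω | S t ω = 0} := hS.origin_avoid ha T t
        _ ≤ avoidProb a T 0 * 1 := mul_le_mul_of_nonneg_left measureReal_le_one h2
        _ ≤ 0 + ε := by linarith
    rw [measureReal_eq_zero_iff] at h0
    filter_upwards [compl_mem_ae_iff.2 h0] with ω hω
    simp only [Set.mem_compl_iff, Set.mem_ofPred_eq] at hω
    intro hz
    by_contra! hcon
    exact hω ⟨hz, hcon⟩
  filter_upwards [hS.start, ae_all_iff.2 hL] with ω h0 hω
  rw [Filter.frequently_atTop]
  intro n
  induction n with
  | zero => exact ⟨0, le_rfl, h0⟩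
  | succ n ih =>
    obtain ⟨m, hm, hz⟩ := ih
    obtain ⟨k, hk, hz'⟩ := hω m hz
    exact ⟨k, by omega, hz'⟩

theorem isTransientWalk_of_sum_le {K : ℝ}
    (h : ∀ T, ∑ t ∈ Finset.range T, P.real {ω | S t ω = 0} ≤ K) : IsTransientWalk P S := by
  have hs : Summable fun t => P.real {ω | S t ω = 0} :=
    summable_of_sum_range_le (fun _ => measureReal_nonneg) h
  refine ae_eventually_notMem (s := fun t => {ω | S t ω = 0}) ?_
  have h2 := hs.tsum_ofReal_ne_top
  rwa [tsum_congr fun t => ofReal_measureReal (μ := P) (s := {ω | S t ω = 0})] at h2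

end Walk

/-! ### Energy of the Green density and the expected number of visits. -/

section Occupation

variable {Ω : Type*} [MeasurableSpace Ω] {P : Measure Ω} {d : ℕ} {α : Fin d → ℝ} {c : ℝ}
  {a : Fin d → ℤ → ℝ} {S : ℕ → Ω → Fin d → ℤ}

theorem IsModelFour.prob_nonneg (ha : IsModelFour d α c a) (x : Fin d → ℤ) (s : WalkStep d) :
    0 ≤ WalkStep.prob a x s := by
  obtain _ | ⟨i, _⟩ := s
  · have := ha.two_mul_sum_le x
    simp only [WalkStep.prob]
    linarith
  · exact (ha.pos i _).le

/-- The expected number of visits before time `T`, as a density with respect to the reversible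
measure. -/
noncomputable def greenDensity (P : Measure Ω) (a : Fin d → ℤ → ℝ) (S : ℕ → Ω → Fin d → ℤ)
    (T : ℕ) (x : Fin d → ℤ) : ℝ :=
  invMass a x * ∑ t ∈ Finset.range T, P.real {ω | S t ω = x}

variable [IsProbabilityMeasure P]

theorem IsLazyWalk.measureReal_zero (hS : IsLazyWalk P a S) (x : Fin d → ℤ) :
    P.real {ω | S 0 ω = x} = if x = 0 then 1 else 0 := by
  split_ifs with h
  · rw [← probReal_univ (μ := P)]
    refine measureReal_congr ?_
    filter_upwards [hS.start] with ω hω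
    exact propext ⟨fun _ => trivial, fun _ => hω.trans h.symm⟩
  · rw [← measureReal_empty (μ := P)]
    refine measureReal_congr ?_
    filter_upwards [hS.start] with ω hω
    exact propext ⟨fun h' => h (h'.symm.trans hω), fun h' => h'.elim⟩

theorem IsLazyWalk.measureReal_succ_eq (hS : IsLazyWalk P a S) (ha : IsModelFour d α c a)
    (t : ℕ) (x : Fin d → ℤ) :
    P.real {ω | S (t + 1) ω = x} = (1 - 2 * ∑ i, a i (x i)) * P.real {ω | S t ω = x} +
      ∑ i, (a i (x i - 1) * P.real {ω | S t ω = x - Pi.single i 1} +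
        a i (x i + 1) * P.real {ω | S t ω = x + Pi.single i 1}) := by
  rw [hS.measureReal_succ ha.prob_nonneg]
  simp [Fintype.sum_option, Fintype.sum_prod_type, WalkStep.prob, WalkStep.vec]

/-- The forward equation for the law becomes, by detailed balance, the backward equation for its
density with respect to the reversible measure. -/
theorem IsLazyWalk.invMass_mul_sub_eq_generator (hS : IsLazyWalk P a S)
    (ha : IsModelFour d α c a) (t : ℕ) (x : Fin d → ℤ) :
    invMass a x * P.real {ω | S (t + 1) ω = x} - invMass a x * P.real {ω | S t ω = x} =
      generator a (fun x => invMass a x * P.real {ω | S t ω = x}) x := by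
  rw [hS.measureReal_succ_eq ha, generator]
  have h : ∀ i, a i (x i) * (invMass a (x + Pi.single i 1) *
      P.real {ω | S t ω = x + Pi.single i 1} + invMass a (x - Pi.single i 1) *
      P.real {ω | S t ω = x - Pi.single i 1} - 2 * (invMass a x * P.real {ω | S t ω = x})) =
      invMass a x * (a i (x i - 1) * P.real {ω | S t ω = x - Pi.single i 1} +
        a i (x i + 1) * P.real {ω | S t ω = x + Pi.single i 1}) -
      a i (x i) * (2 * (invMass a x * P.real {ω | S t ω = x})) := by
    intro i
    have h1 := invMass_add_single a i x 1
    have h2 := invMass_add_single a i x (-1)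
    rw [Pi.single_neg, ← sub_eq_add_neg, ← sub_eq_add_neg] at h2
    linear_combination P.real {ω | S t ω = x + Pi.single i 1} * h1 +
      P.real {ω | S t ω = x - Pi.single i 1} * h2
  rw [Finset.sum_congr rfl fun i _ => h i, Finset.sum_sub_distrib, ← Finset.mul_sum,
    ← Finset.sum_mul]
  ring

theorem generator_sum {ι : Type*} (s : Finset ι) (F : ι → (Fin d → ℤ) → ℝ) (x : Fin d → ℤ) :
    generator a (fun x => ∑ t ∈ s, F t x) x = ∑ t ∈ s, generator a (F t) x := by
  simp only [generator]
  rw [Finset.sum_comm]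
  refine Finset.sum_congr rfl fun i _ => ?_
  rw [← Finset.mul_sum, Finset.sum_sub_distrib, Finset.sum_add_distrib, ← Finset.mul_sum]

theorem IsLazyWalk.generator_greenDensity (hS : IsLazyWalk P a S) (ha : IsModelFour d α c a)
    (T : ℕ) (x : Fin d → ℤ) :
    generator a (greenDensity P a S T) x =
      invMass a x * (P.real {ω | S T ω = x} - P.real {ω | S 0 ω = x}) := by
  have h : greenDensity P a S T =
      fun x => ∑ t ∈ Finset.range T, invMass a x * P.real {ω | S t ω = x} := by
    ext x
    rw [greenDensity, Finset.mul_sum]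
  rw [h, generator_sum, Finset.sum_congr rfl fun t _ =>
    (hS.invMass_mul_sub_eq_generator ha t x).symm,
    Finset.sum_range_sub (fun t => invMass a x * P.real {ω | S t ω = x}), mul_sub]

theorem IsLazyWalk.finite_support_measureReal (hS : IsLazyWalk P a S)
    (ha : IsModelFour d α c a) (t : ℕ) :
    (fun x => P.real {ω | S t ω = x}).support.Finite := by
  induction t with
  | zero =>
    refine (Set.finite_singleton 0).subset fun x hx => ?_
    simpa [hS.measureReal_zero] using hx
  | succ t ih =>
    refine (Set.finite_iUnion fun s : WalkStep d =>
      finite_support_comp_add ih (-s.vec)).subset fun x hx => ?_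
    simp only [Function.mem_support, hS.measureReal_succ ha.prob_nonneg] at hx
    obtain ⟨s, -, hs⟩ := Finset.exists_ne_zero_of_sum_ne_zero hx
    rw [Set.mem_iUnion]
    exact ⟨s, by simpa [← sub_eq_add_neg] using right_ne_zero_of_mul hs⟩

theorem IsLazyWalk.finite_support_greenDensity (hS : IsLazyWalk P a S)
    (ha : IsModelFour d α c a) (T : ℕ) : (greenDensity P a S T).support.Finite := by
  refine (Set.finite_iUnion fun t : Fin T =>
    hS.finite_support_measureReal ha t).subset fun x hx => ?_
  obtain ⟨t, ht, h⟩ := Finset.exists_ne_zero_of_sum_ne_zero (right_ne_zero_of_mul hx)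
  exact Set.mem_iUnion.2 ⟨⟨t, Finset.mem_range.1 ht⟩, h⟩

/-- Green's formula meets the telescoped sum over time: only the laws at times `T` and `0` remain,
and the latter is the point mass at the origin. -/
theorem IsLazyWalk.dirichletForm_greenDensity (hS : IsLazyWalk P a S)
    (ha : IsModelFour d α c a) (T : ℕ) {g : (Fin d → ℤ) → ℝ} (hg : g.support.Finite) :
    dirichletForm a (greenDensity P a S T) g = g 0 - ∑' x, P.real {ω | S T ω = x} * g x := by
  have h := ha.tsum_mul_generator (greenDensity P a S T) hg
  have h1 : ∑' x, g x * generator a (greenDensity P a S T) x / invMass a x =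
      ∑' x, P.real {ω | S T ω = x} * g x - ∑' x, P.real {ω | S 0 ω = x} * g x := by
    rw [← (summable_mul_of_finite_support hg _).tsum_sub (summable_mul_of_finite_support hg _)]
    refine tsum_congr fun x => ?_
    rw [hS.generator_greenDensity ha]
    have := (ha.invMass_pos x).ne'
    field_simp
  have h2 : ∑' x, P.real {ω | S 0 ω = x} * g x = g 0 := by
    simp [hS.measureReal_zero, ite_mul, tsum_ite_eq]
  rw [h1, h2] at h
  linarith

theorem IsLazyWalk.dirichletForm_greenDensity_self_le (hS : IsLazyWalk P a S)
    (ha : IsModelFour d α c a) (T : ℕ) :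
    dirichletForm a (greenDensity P a S T) (greenDensity P a S T) ≤ greenDensity P a S T 0 := by
  rw [hS.dirichletForm_greenDensity ha T (hS.finite_support_greenDensity ha T), sub_le_self_iff]
  exact tsum_nonneg fun x => mul_nonneg measureReal_nonneg
    (mul_nonneg (ha.invMass_pos x).le (Finset.sum_nonneg fun _ _ => measureReal_nonneg))

theorem IsModelFour.sum_tsum_le_dirichletForm (ha : IsModelFour d α c a)
    {F : (Fin d → ℤ) → ℝ} (hF : F.support.Finite) :
    ∑ i, ∑' x, (F (x + Pi.single i 1) - F x) ^ 2 ≤ dirichletForm a F F := by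
  refine Finset.sum_le_sum fun i _ => Summable.tsum_le_tsum (fun x => ?_) ?_ ?_
  · rw [← sq]
    exact le_mul_of_one_le_left (sq_nonneg _) (ha.one_le_conductance i x)
  · simpa only [sq] using summable_mul_of_finite_support (finite_support_diff hF _) _
  · simpa only [mul_assoc] using summable_mul_of_finite_support
      (finite_support_diff hF (Pi.single i (1 : ℤ)))
      (fun x => conductance a i x * (F (x + Pi.single i 1) - F x))

theorem IsModelFour.dirichletForm_le_sum_tsum (ha : IsModelFour d α c a)
    {F : (Fin d → ℤ) → ℝ} (hF : F.support.Finite) :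
    dirichletForm a F F ≤ 1 / c ^ d * ∑ i, ∑' x, (F (x + Pi.single i 1) - F x) ^ 2 := by
  rw [Finset.mul_sum]
  refine Finset.sum_le_sum fun i _ => ?_
  rw [← tsum_mul_left]
  refine Summable.tsum_le_tsum (fun x => ?_) ?_ (Summable.mul_left _ ?_)
  · rw [← sq]
    exact mul_le_mul_of_nonneg_right (ha.conductance_le i x) (sq_nonneg _)
  · simpa only [mul_assoc] using summable_mul_of_finite_support
      (finite_support_diff hF (Pi.single i (1 : ℤ)))
      (fun x => conductance a i x * (F (x + Pi.single i 1) - F x))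
  · simpa only [sq] using summable_mul_of_finite_support (finite_support_diff hF _) _

/-- In dimension at least three, the expected number of visits of the origin is finite. -/
theorem IsLazyWalk.sum_measureReal_le (hS : IsLazyWalk P a S) (ha : IsModelFour d α c a)
    (hd : 3 ≤ d) (T : ℕ) :
    ∑ t ∈ Finset.range T, P.real {ω | S t ω = 0} ≤ 213 / invMass a 0 := by
  have hF := hS.finite_support_greenDensity ha T
  have h1 := sq_apply_zero_le hd hF
  have h2 := (ha.sum_tsum_le_dirichletForm hF).trans (hS.dirichletForm_greenDensity_self_le ha T)
  have h0 : 0 ≤ greenDensity P a S T 0 :=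
    mul_nonneg (ha.invMass_pos 0).le (Finset.sum_nonneg fun _ _ => measureReal_nonneg)
  -- The estimates combine to `G² ≤ 213 G` for the value `G` at the origin.
  have h3 : greenDensity P a S T 0 ≤ 213 := by
    by_contra! h
    nlinarith
  rw [le_div_iff₀ (ha.invMass_pos 0), mul_comm]
  exact h3

/-- A walk at `x` takes the step `s` with a fixed positive probability, so the mass at `x` at time
`t` is at most a constant times the mass at `x + s.vec` at time `t + 1`. -/
theorem IsLazyWalk.tendsto_measureReal_of_neighbor (hS : IsLazyWalk P a S)
    (x : Fin d → ℤ) {s : WalkStep d} (hs : 0 < WalkStep.prob a x s)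
    (h : Filter.Tendsto (fun t => P.real {ω | S t ω = x + s.vec}) Filter.atTop (nhds 0)) :
    Filter.Tendsto (fun t => P.real {ω | S t ω = x}) Filter.atTop (nhds 0) := by
  have h1 : Filter.Tendsto (fun t => (WalkStep.prob a x s)⁻¹ * P.real {ω | S (t + 1) ω = x + s.vec})
      Filter.atTop (nhds 0) := by
    simpa using ((Filter.tendsto_add_atTop_iff_nat 1).2 h).const_mul (WalkStep.prob a x s)⁻¹
  refine squeeze_zero (fun _ => measureReal_nonneg) (fun t => ?_) h1
  rw [inv_mul_eq_div, le_div_iff₀ hs, mul_comm, ← hS.point_step t x s hs.le]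
  refine measureReal_mono fun ω hω => ?_
  obtain ⟨rfl, hω⟩ := hω
  exact hω

theorem IsLazyWalk.tendsto_measureReal (hS : IsLazyWalk P a S) (ha : IsModelFour d α c a)
    (h : Filter.Tendsto (fun t => P.real {ω | S t ω = 0}) Filter.atTop (nhds 0))
    (x : Fin d → ℤ) : Filter.Tendsto (fun t => P.real {ω | S t ω = x}) Filter.atTop (nhds 0) := by
  -- Induction on the `ℓ¹` norm: from `x ≠ 0` some step moves one coordinate closer to zero.
  induction hn : ∑ i, (x i).natAbs using Nat.strong_induction_on generalizing x with
  | _ n ih =>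
    by_cases hx : x = 0
    · rwa [hx]
    obtain ⟨i, hi⟩ := Function.ne_iff.1 hx
    have key : ∀ b : Bool, ((x + WalkStep.vec (some (i, b))) i).natAbs < (x i).natAbs →
        (∀ j ≠ i, WalkStep.vec (some (i, b)) j = 0) →
        Filter.Tendsto (fun t => P.real {ω | S t ω = x}) Filter.atTop (nhds 0) := by
      intro b hb hb'
      refine hS.tendsto_measureReal_of_neighbor x (s := some (i, b)) (ha.pos i _) (ih _ ?_ _ rfl)
      rw [← hn]
      refine Finset.sum_lt_sum (fun j _ => ?_) ⟨i, Finset.mem_univ i, hb⟩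
      by_cases hj : j = i
      · subst hj; exact hb.le
      · rw [Pi.add_apply, hb' j hj, add_zero]
    obtain hlt | hgt := lt_or_gt_of_ne hi
    · refine key true ?_ fun j hj => Pi.single_eq_of_ne hj _
      simp only [Pi.zero_apply] at hlt
      simp only [WalkStep.vec, Pi.add_apply, Pi.single_eq_same]
      omega
    · refine key false ?_ fun j hj => by simp [WalkStep.vec, Pi.single_eq_of_ne hj]
      simp only [Pi.zero_apply] at hgt
      simp only [WalkStep.vec, Pi.add_apply, Pi.neg_apply, Pi.single_eq_same]
      omega

/-- In dimension at most two, the expected number of visits of the origin is infinite. -/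
theorem IsLazyWalk.not_exists_sum_measureReal_le (hS : IsLazyWalk P a S)
    (ha : IsModelFour d α c a) (hd : d ≤ 2) :
    ¬ ∃ K, ∀ T, ∑ t ∈ Finset.range T, P.real {ω | S t ω = 0} ≤ K := by
  rintro ⟨K, hK⟩
  have hc := ha.c_pos
  have hsum : Summable fun t => P.real {ω | S t ω = 0} :=
    summable_of_sum_range_le (fun _ => measureReal_nonneg) hK
  have hlim := hS.tendsto_measureReal ha hsum.tendsto_atTop_zero
  obtain ⟨K', hK', hG⟩ : ∃ K' : ℝ, 0 < K' ∧ ∀ T, greenDensity P a S T 0 ≤ K' := by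
    -- The maximum with `1` keeps the bound positive, since it is divided by below.
    refine ⟨max 1 (invMass a 0 * K), by positivity, fun T => le_max_of_le_right ?_⟩
    exact mul_le_mul_of_nonneg_left (hK T) (ha.invMass_pos 0).le
  -- The factor `c ^ d` offsets the bound on the conductances; with at most two directions the
  -- energy of `g` is then at most `1 / (4 K')`.
  obtain ⟨g, hg, hg0, hgε⟩ := exists_cutoff (d := d) hd (ε := c ^ d / (8 * K')) (by positivity)
  have hgE : dirichletForm a g g ≤ 1 / (4 * K') := by
    have hd' : (d : ℝ) ≤ 2 := by exact_mod_cast hd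
    calc _ ≤ 1 / c ^ d * ∑ i, ∑' x, (g (x + Pi.single i 1) - g x) ^ 2 :=
          ha.dirichletForm_le_sum_tsum hg
      _ ≤ 1 / c ^ d * ∑ _i : Fin d, c ^ d / (8 * K') := by
          gcongr with i
          exact hgε i
      _ = d * (1 / (8 * K')) := by
          rw [Finset.sum_const, Finset.card_univ, Fintype.card_fin, nsmul_eq_mul]
          field_simp
      _ ≤ 2 * (1 / (8 * K')) := by gcongr
      _ = _ := by field_simp; norm_num
  have hbound : ∀ T, 2 * (1 - ∑' x, P.real {ω | S T ω = x} * g x) ≤ 3 / 2 := by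
    intro T
    -- The weight `r = 1 / (2 K')` makes each of the two energy terms at most `1 / 2`.
    have h1 := ha.two_mul_dirichletForm_le (hS.finite_support_greenDensity ha T) hg
      (r := 1 / (2 * K')) (by positivity)
    rw [hS.dirichletForm_greenDensity ha T hg, hg0] at h1
    have h2 : 1 / (2 * K') * dirichletForm a (greenDensity P a S T) (greenDensity P a S T) ≤
        1 / (2 * K') * K' := by
      gcongr
      exact (hS.dirichletForm_greenDensity_self_le ha T).trans (hG T)
    have h3 : (1 / (2 * K'))⁻¹ * dirichletForm a g g ≤ (1 / (2 * K'))⁻¹ * (1 / (4 * K')) := by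
      gcongr
    have h4 : 1 / (2 * K') * K' = 1 / 2 := by field_simp
    have h5 : (1 / (2 * K'))⁻¹ * (1 / (4 * K')) = 1 / 2 := by field_simp; norm_num
    linarith
  have hzero : Filter.Tendsto (fun T => ∑' x, P.real {ω | S T ω = x} * g x) Filter.atTop
      (nhds 0) := by
    have h1 : ∀ T, ∑' x, P.real {ω | S T ω = x} * g x =
        ∑ x ∈ hg.toFinset, P.real {ω | S T ω = x} * g x := fun T =>
      tsum_eq_sum fun x hx => by
        rw [Set.Finite.mem_toFinset, Function.notMem_support] at hx
        rw [hx, mul_zero]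
    simp_rw [h1]
    simpa using tendsto_finsetSum hg.toFinset fun x _ => (hlim x).mul_const (g x)
  -- Once the mean of `g` is below `1 / 4`, the left side of `hbound` exceeds `3 / 2`.
  obtain ⟨T, hT⟩ := (hzero.eventually_lt_const (show (0 : ℝ) < 1 / 4 by norm_num)).exists
  linarith [hbound T]

end Occupation

theorem proposition5 {Ω : Type*} [MeasurableSpace Ω] (P : Measure Ω) [IsProbabilityMeasure P]
    (d : ℕ) (α : Fin d → ℝ) (c : ℝ) (a : Fin d → ℤ → ℝ) (ha : IsModelFour d α c a)
    (S : ℕ → Ω → Fin d → ℤ) (hS : IsLazyWalk P a S) :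
    (d ≤ 2 → IsRecurrentWalk P S) ∧ (3 ≤ d → IsTransientWalk P S) :=
  ⟨fun hd => hS.isRecurrentWalk ha.prob_nonneg (hS.not_exists_sum_measureReal_le ha hd),
    fun hd => isTransientWalk_of_sum_le (hS.sum_measureReal_le ha hd)⟩
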